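/- **Conventions.** All hypergraphs are finite and have no repeated edges. A hypergraph is $n$-uniform (an $n$-graph) if every edge has exactly $n$ vertices; the degree of a vertex is the number of edges containing it. In the Maker-Breaker game on a hypergraph $G$, two players alternately claim previously unclaimed vertices until all vertices are claimed. Maker wins if at some point he has claimed all vertices of an edge; otherwise Breaker wins. "A player wins" means that he has a winning strategy. Maker moves first. For $n\ge 1$ let $f(n)$ be the least integer $d$ for which there is an $n$-graph of maximum degree at most $d$ on which Maker wins. **Construction.** Let $\Gamma$ be the $3$-graph with vertices $w_i, x_{ij}, t_{ij}$ ($i\in\{1,\dots,5\}$, $j\in\{1,2,3\}$) and edges $\{w_i,x_{ij},t_{ij}\}$ for all $i,j$, together with $e_i=\{x_{i,1},x_{i+2,2},x_{i+3,3}\}$ for all $i$ (first indices modulo $5$). Let $\Gamma'$ be obtained from $\Gamma$ by adding, for all $i,j$, new vertices $y_{ijk}$ ($1\le k\le 6$) and $z_{ijk}$ ($1\le k\le 4$), and replacing the edge $\{w,x,t\}=\{w_i,x_{ij},t_{ij}\}$ by the seven edges $$\{w,t,y_1,y_2\},\ \{x,t,y_3,y_4\},\ \{x,t,y_5,y_6\},\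 \{y_1,y_3,y_5,z_1\},\ \{y_1,y_3,y_5,z_2\},\ \{y_2,y_4,y_6,z_3\},\ \{y_2,y_4,y_6,z_4\},$$ where $y_k=y_{ijk}$ and $z_k=z_{ijk}$. Let $G_4$ be obtained from three disjoint copies $\Gamma'_1,\Gamma'_2,\Gamma'_3$ of $\Gamma'$ by adding new vertices $v_1,v_2,v_3,v_4,s_1,s_2,s_3$; replacing, for each $a\in\{1,2,3\}$, the $3$-edges $e_{a1},e_{a2}$ of $\Gamma'_a$ (the copies of $e_1,e_2$) by $e_{a1}\cup\{v_a\},e_{a2}\cup\{v_a\}$, and the $3$-edges $e_{a3},e_{a4},e_{a5}$ by $e_{a3}\cup\{s_a\},e_{a4}\cup\{s_a\},e_{a5}\cup\{s_a\}$; and adding the edge $\{v_1,v_2,v_3,v_4\}$. **Theorem.** 1. $G_4$ is a $4$-uniform hypergraph with maximum degree exactly $3$, with $562$ vertices and $331$ edges, and Maker, moving first, wins the Maker-Breaker game on $G_4$. 2. For every $n\ge 1$, Breaker wins the Maker-Breaker game (Maker moving first) on every $n$-graph of maximum degree at most $n/2$. Consequently $f(n)>n/2$ for every $n\ge1$. 3.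 $f(4)=3$. In particular there is a $4$-graph of maximum degree $3$ on which Maker wins, which answers Leader's question affirmatively. -/

import Mathlib

open scoped Hypergraph

namespace Hypergraph

variable {α : Type*}

/-- `H` is `n`-uniform: every edge has exactly `n` vertices (used for finite hypergraphs). -/
def IsUniform (H : Hypergraph α) (n : ℕ) : Prop := ∀ e ∈ E(H), e.ncard = n

/-- The degree of `v`: the number of edges containing `v`. -/
noncomputable def degree (H : Hypergraph α) (v : α) : ℕ := {e | e ∈ E(H) ∧ v ∈ e}.ncard

/-- The maximum vertex degree (of a finite hypergraph; it is `0` if there are no vertices). -/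
noncomputable def maxDegree (H : Hypergraph α) : ℕ := sSup (H.degree '' V(H))

end Hypergraph

namespace MakerBreaker

inductive Player
  | maker
  | breaker

/-- The player who moves after the given one. -/
def Player.other : Player → Player
  | .maker => .breaker
  | .breaker => .maker

/-- A position of the Maker-Breaker game: the vertices claimed so far by Maker and by Breaker,
and the player whose turn it is. -/
structure Position (α : Type*) where
  maker : Set α
  breaker : Set α
  turn : Player

variable {α : Type*}

/-- The initial position, in which nothing has been claimed and `first` is to move. -/
def Position.start (first : Player) : Position α := ⟨∅, ∅, first⟩

/-- The position after the player whose turn it is has claimed `v`. -/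
def Position.claim : Position α → α → Position α
  | ⟨M, B, .maker⟩, v => ⟨insert v M, B, .breaker⟩
  | ⟨M, B, .breaker⟩, v => ⟨M, insert v B, .maker⟩

/-- The vertices of `H` which are still unclaimed. -/
def Position.free (p : Position α) (H : Hypergraph α) : Set α := V(H) \ (p.maker ∪ p.breaker)

/-- A strategy chooses an unclaimed vertex in every position in which there is one. -/
def Strategy (H : Hypergraph α) : Type _ :=
  ∀ p : Position α, (p.free H).Nonempty → {v : α // v ∈ p.free H}

/-- The positions that can arise when player `P` follows the strategy `σ`, the opponent claims
arbitrary unclaimed vertices, and `first` makes the first move. -/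
inductive Reachable (H : Hypergraph α) (P : Player) (σ : Strategy H) (first : Player) :
    Position α → Prop
  | start : Reachable H P σ first (Position.start first)
  | own {p : Position α} (hp : Reachable H P σ first p) (hturn : p.turn = P)
      (hfree : (p.free H).Nonempty) : Reachable H P σ first (p.claim (σ p hfree).1)
  | opponent {p : Position α} (hp : Reachable H P σ first p) (hturn : p.turn = P.other)
      {v : α} (hv : v ∈ p.free H) : Reachable H P σ first (p.claim v)

/-- Maker has a winning strategy for the game on the (finite) hypergraph `H` in which `first`
makes the first move: following it, by the time that all vertices have been claimed he has
claimed all vertices of some edge. (Claimed vertices stay claimed, so this says that he claims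
an edge at some point of the game.) -/
def MakerWins (H : Hypergraph α) (first : Player) : Prop :=
  ∃ σ : Strategy H, ∀ p : Position α, Reachable H .maker σ first p → p.free H = ∅ →
    ∃ e ∈ E(H), e ⊆ p.maker

/-- Breaker has a winning strategy for the game on the (finite) hypergraph `H` in which `first`
makes the first move: if he follows it, then at no point has Maker claimed all vertices of an
edge. -/
def BreakerWins (H : Hypergraph α) (first : Player) : Prop :=
  ∃ σ : Strategy H, ∀ p : Position α, Reachable H .breaker σ first p →
    ∀ e ∈ E(H), ¬ e ⊆ p.maker

/-- `f n` is the least `d` for which there is a (finite) `n`-uniform hypergraph of maximum degree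
at most `d` on which Maker, moving first, wins. -/
noncomputable def f (n : ℕ) : ℕ :=
  sInf {d : ℕ | ∃ (α : Type) (H : Hypergraph α), V(H).Finite ∧ H.IsUniform n ∧
    H.maxDegree ≤ d ∧ MakerWins H .maker}

/-! The indices `i ∈ {1, …, 5}`, `j ∈ {1, 2, 3}`, … are shifted to start at `0`; addition in
`Fin 5` is modulo `5`. -/

/-- The vertices `w_i`, `x_{ij}`, `t_{ij}` of `Γ`. -/
inductive GammaVertex
  | w (i : Fin 5)
  | x (i : Fin 5) (j : Fin 3)
  | t (i : Fin 5) (j : Fin 3)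
  deriving DecidableEq, Fintype

namespace GammaVertex

/-- The edge `w_i x_{ij} t_{ij}` of `Γ`. -/
def spoke (i : Fin 5) (j : Fin 3) : Set GammaVertex := {w i, x i j, t i j}

/-- The edge `e_i = x_{i,1} x_{i+2,2} x_{i+3,3}` of `Γ`. -/
def core (i : Fin 5) : Set GammaVertex := {x i 0, x (i + 2) 1, x (i + 3) 2}

end GammaVertex

/-- The `3`-graph `Γ`. -/
def Gamma : Hypergraph GammaVertex where
  vertexSet := Set.univ
  edgeSet := {e | ∃ i j, e = GammaVertex.spoke i j} ∪ {e | ∃ i, e = GammaVertex.core i}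
  subset_vertexSet_of_mem_edgeSet' := fun _ _ => Set.subset_univ _

/-- The vertices of `Γ'`: those of `Γ` and new vertices `y_{ijk}`, `z_{ijk}`. -/
inductive GammaPrimeVertex
  | old (u : GammaVertex)
  | y (i : Fin 5) (j : Fin 3) (k : Fin 6)
  | z (i : Fin 5) (j : Fin 3) (k : Fin 4)
  deriving DecidableEq, Fintype

namespace GammaPrimeVertex

/-- The seven `4`-edges which replace the edge `w_i x_{ij} t_{ij}` of `Γ`. -/
def gadget (i : Fin 5) (j : Fin 3) : Set (Set GammaPrimeVertex) :=
  { {old (.w i), old (.t i j), y i j 0, y i j 1},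
    {old (.x i j), old (.t i j), y i j 2, y i j 3},
    {old (.x i j), old (.t i j), y i j 4, y i j 5},
    {y i j 0, y i j 2, y i j 4, z i j 0},
    {y i j 0, y i j 2, y i j 4, z i j 1},
    {y i j 1, y i j 3, y i j 5, z i j 2},
    {y i j 1, y i j 3, y i j 5, z i j 3} }

/-- The `3`-edge `e_i`, as an edge of `Γ'`. -/
def core (i : Fin 5) : Set GammaPrimeVertex := old '' GammaVertex.core i

end GammaPrimeVertex

/-- The hypergraph `Γ'`: every edge `w_i x_{ij} t_{ij}` of `Γ` is replaced by its gadget. -/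
def GammaPrime : Hypergraph GammaPrimeVertex where
  vertexSet := Set.univ
  edgeSet := {e | ∃ e₀ ∈ E(Gamma), (∀ i j, e₀ ≠ GammaVertex.spoke i j) ∧
      e = GammaPrimeVertex.old '' e₀} ∪
    {e | ∃ i j, e ∈ GammaPrimeVertex.gadget i j}
  subset_vertexSet_of_mem_edgeSet' := fun _ _ => Set.subset_univ _

/-- The vertices of `G₄`: those of three disjoint copies of `Γ'` and the extra vertices
`v_1, v_2, v_3, v_4` and `s_1, s_2, s_3`. -/
inductive G4Vertex
  | copy (a : Fin 3) (u : GammaPrimeVertex)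
  | v (b : Fin 4)
  | s (a : Fin 3)
  deriving DecidableEq, Fintype

namespace G4Vertex

/-- The vertex added to the edge `e_i` of the `a`-th copy of `Γ'`: it is `v_a` for the first two
of these edges and `s_a` for the other three. -/
def apex (a : Fin 3) (i : Fin 5) : G4Vertex := if i = 0 ∨ i = 1 then v a.castSucc else s a

end G4Vertex

/-- The hypergraph `G₄`: in each of three disjoint copies of `Γ'` the five `3`-edges are enlarged
by an extra vertex, and the edge `v_1 v_2 v_3 v_4` is added. -/
def G4 : Hypergraph G4Vertex where
  vertexSet := Set.univ
  edgeSet := {e | ∃ a, ∃ e₀ ∈ E(GammaPrime), (∀ i, e₀ ≠ GammaPrimeVertex.core i) ∧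
      e = G4Vertex.copy a '' e₀} ∪
    {e | ∃ a i, e = insert (G4Vertex.apex a i) (G4Vertex.copy a '' GammaPrimeVertex.core i)} ∪
    {{.v 0, .v 1, .v 2, .v 3}}
  subset_vertexSet_of_mem_edgeSet' := fun _ _ => Set.subset_univ _

end MakerBreaker

/-! Breaker's bound is a pairing argument. If the maximum degree is at most `n / 2`, double counting
verifies Hall's condition for two copies of every edge, so all edges contain pairwise disjoint pairs
of vertices. Breaker answers each Maker vertex with its partner and so meets every edge. For `n = 4`
this gives `f 4 > 2`.

Maker's win on `G₄` is a chain of forcing moves. If Maker owns `w`, `x`, `t` of an otherwise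
untouched gadget, he wins there even with Breaker to move (`wins_of_gadget`). So once he owns `w`,
claiming `x` forces a reply inside the gadget (`wins_of_spoke`). Call the three gadgets whose `x`
lies in `e_c` the region of `c`; the five regions are disjoint. If the region is untouched and Maker
owns the apex of `e_c` and two of the three `w`s belonging to the region, he takes two vertices `x`
of `e_c` with tempo and completes the edge with the third (`wins_of_core`).

The first indices of `e_c` form the translate `c + {0, 2, 3}` modulo 5. Two residues at distance 2
lie in two translates, so two such `w`s create threats in two disjoint regions. There is enough
slack for Maker to win a copy whose apexes are all his even if Breaker moves first there
(`wins_of_copy`). Hence owning `v_a` threatens to claim `s_a`, and Breaker must answer each of the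
three `v_a` within the `a`-th copy or at `s_a`. The fourth `v` then completes the top edge. -/

namespace MakerBreaker

/-! ### Forced wins and strategies -/

variable {α : Type*}

/-- `Wins E M B`: Maker, who is to move and has claimed `M` while Breaker has claimed `B`, can
force the claim of a member of `E`. Both players are allowed to waste a move. -/
inductive Wins (E : Set (Set α)) : Set α → Set α → Prop
  | edge {M B : Set α} {m : α} {e : Set α} (he : e ∈ E) (hm : m ∉ B) (hsub : e ⊆ insert m M) :
      Wins E M B
  | move {M B : Set α} {m : α} (hm : m ∉ B)
      (h : ∀ b, b ∉ insert m M → Wins E (insert m M) (insert b B)) : Wins E M B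

namespace Wins

variable {E : Set (Set α)} {M M' B B' : Set α}

/-- Extra Maker vertices can turn a planned move into a repetition; the induction survives because
wasted moves are legal. -/
theorem mono (h : Wins E M B) (hM : M ⊆ M') (hB : B' ⊆ B) : Wins E M' B' := by
  induction h generalizing M' B' with
  | edge he hm hsub =>
    exact .edge he (fun h => hm (hB h)) (hsub.trans (Set.insert_subset_insert hM))
  | move hm _ ih =>
    refine .move (fun h => hm (hB h)) fun b hb => ?_
    exact ih b (fun h => hb (Set.insert_subset_insert hM h)) (Set.insert_subset_insert hM)
      (Set.insert_subset_insert hB)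

/-- If claiming `m` threatens to complete an edge at `b`, then Breaker has to reply `b`. -/
theorem force {m b : α} {e : Set α} (he : e ∈ E) (hm : m ∉ B) (hb : b ∉ B)
    (hsub : e ⊆ insert b (insert m M)) (h : Wins E (insert m M) (insert b B)) : Wins E M B := by
  refine .move hm fun b' _ => ?_
  by_cases hbb : b' = b
  · rwa [hbb]
  · exact .edge he (m := b) (by simp [hb, Ne.symm hbb]) hsub

theorem double {m b b' : α} {e e' : Set α} (he : e ∈ E) (he' : e' ∈ E) (hm : m ∉ B) (hb : b ∉ B)
    (hb' : b' ∉ B) (hne : b ≠ b') (hsub : e ⊆ insert b (insert m M))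
    (hsub' : e' ⊆ insert b' (insert m M)) : Wins E M B :=
  .force he hm hb hsub (.edge he' (m := b') (by simp [hb', hne.symm]) hsub')

/-- On a full board every remaining move of the tree is wasted. `hE` serves the case in which Maker
owns everything, where `move` holds vacuously. -/
theorem exists_subset (h : Wins E M B) (hE : E.Nonempty) (huniv : M ∪ B = Set.univ) :
    ∃ e ∈ E, e ⊆ M := by
  induction h with
  | @edge M B m e he hm hsub =>
    have hmM : m ∈ M := (huniv.symm ▸ Set.mem_univ m : m ∈ M ∪ B).resolve_right hm
    exact ⟨e, he, by rwa [Set.insert_eq_of_mem hmM] at hsub⟩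
  | @move M B m hm _ ih =>
    have hmM : m ∈ M := (huniv.symm ▸ Set.mem_univ m : m ∈ M ∪ B).resolve_right hm
    rw [Set.insert_eq_of_mem hmM] at ih
    by_cases hM : ∃ b, b ∉ M
    · obtain ⟨b, hb⟩ := hM
      exact ih b hb (by rw [Set.union_insert, huniv, Set.insert_eq_of_mem (Set.mem_univ b)])
    · push Not at hM
      obtain ⟨e, he⟩ := hE
      exact ⟨e, he, fun v _ => hM v⟩

end Wins

/-- The positions from which Maker can win. -/
def Position.Good (H : Hypergraph α) (p : Position α) : Prop :=
  (∃ e ∈ E(H), e ⊆ p.maker) ∨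
    (p.turn = .maker ∧ Wins E(H) p.maker p.breaker) ∨
    (p.turn = .breaker ∧ ∀ b ∉ p.maker, Wins E(H) p.maker (insert b p.breaker))

theorem Position.Good.exists_claim {H : Hypergraph α} (hV : V(H) = Set.univ) {p : Position α}
    (hp : p.Good H) (hturn : p.turn = .maker) (hfree : (p.free H).Nonempty) :
    ∃ v ∈ p.free H, (p.claim v).Good H := by
  obtain ⟨M, B, t⟩ := p
  obtain rfl : t = .maker := hturn
  obtain ⟨u, hu⟩ := hfree
  have hmem (v : α) : v ∈ Position.free ⟨M, B, .maker⟩ H ↔ v ∉ M ∧ v ∉ B := by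
    simp [Position.free, hV]
  rcases hp with ⟨e, he, hsub⟩ | ⟨-, hw⟩ | ⟨h, -⟩
  · exact ⟨u, hu, .inl ⟨e, he, hsub.trans (Set.subset_insert _ _)⟩⟩
  · cases hw with
    | @edge _ _ m e he hm hsub =>
      by_cases hmM : m ∈ M
      · rw [Set.insert_eq_of_mem hmM] at hsub
        exact ⟨u, hu, .inl ⟨e, he, hsub.trans (Set.subset_insert _ _)⟩⟩
      · exact ⟨m, (hmem m).2 ⟨hmM, hm⟩, .inl ⟨e, he, hsub⟩⟩
    | @move _ _ m hm h =>
      -- A wasted move is not allowed in the actual game; any free vertex replaces it, by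
      -- monotonicity.
      by_cases hmM : m ∈ M
      · rw [Set.insert_eq_of_mem hmM] at h
        exact ⟨u, hu, .inr (.inr ⟨rfl, fun b hb =>
          (h b fun hb' => hb (.inr hb')).mono (Set.subset_insert _ _) subset_rfl⟩)⟩
      · exact ⟨m, (hmem m).2 ⟨hmM, hm⟩, .inr (.inr ⟨rfl, h⟩)⟩
  · cases h

theorem Wins.makerWins {H : Hypergraph α} (hV : V(H) = Set.univ) (hE : E(H).Nonempty)
    (h : Wins E(H) ∅ ∅) : MakerWins H .maker := by
  classical
  let σ : Strategy H := fun p hfree =>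
    if hp : ∃ v ∈ p.free H, (p.claim v).Good H then ⟨hp.choose, hp.choose_spec.1⟩
    else ⟨hfree.some, hfree.some_mem⟩
  have hσ {p : Position α} (hp : p.Good H) (hturn : p.turn = .maker)
      (hfree : (p.free H).Nonempty) : (p.claim (σ p hfree).1).Good H := by
    have hex := hp.exists_claim hV hturn hfree
    simp only [σ, dif_pos hex]
    exact hex.choose_spec.2
  refine ⟨σ, fun p hp hfree => ?_⟩
  have hgood : p.Good H := by
    clear hfree
    induction hp with
    | start => exact .inr (.inl ⟨rfl, h⟩)
    | own _ hturn hfree ih => exact hσ ih hturn hfree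
    | @opponent p _ hturn v hv ih =>
      obtain ⟨M, B, t⟩ := p
      obtain rfl : t = .breaker := hturn
      rcases ih with h | ⟨h, -⟩ | ⟨-, h⟩
      · exact .inl h
      · cases h
      · exact .inr (.inl ⟨rfl, h v fun hvM => hv.2 (.inl hvM)⟩)
  have huniv : p.maker ∪ p.breaker = Set.univ := by
    rw [← Set.univ_subset_iff, ← hV]
    exact Set.sdiff_eq_empty.1 hfree
  rcases hgood with h | ⟨-, h⟩ | ⟨-, h⟩
  · exact h
  · exact h.exists_subset hE huniv
  · by_cases hM : ∃ b, b ∉ p.maker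
    · obtain ⟨b, hb⟩ := hM
      exact (h b hb).exists_subset hE
        (by rw [Set.union_insert, huniv, Set.insert_eq_of_mem (Set.mem_univ b)])
    · push Not at hM
      obtain ⟨e, he⟩ := hE
      exact ⟨e, he, fun v _ => hM v⟩

theorem Position.free_claim (p : Position α) (H : Hypergraph α) (v : α) :
    (p.claim v).free H = p.free H \ {v} := by
  obtain ⟨M, B, t⟩ := p
  ext u
  cases t <;> simp [Position.free, Position.claim] <;> tauto

/-- Let the two strategies play each other until the board is full. -/
theorem exists_reachable_free_eq_empty {H : Hypergraph α} (hV : V(H).Finite) (σ τ : Strategy H)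
    (first : Player) : ∃ p, Reachable H .maker σ first p ∧ Reachable H .breaker τ first p ∧
      p.free H = ∅ := by
  suffices h : ∀ n (p : Position α), (p.free H).ncard = n → Reachable H .maker σ first p →
      Reachable H .breaker τ first p → ∃ q, Reachable H .maker σ first q ∧
        Reachable H .breaker τ first q ∧ q.free H = ∅ from
    h _ _ rfl .start .start
  intro n
  induction n with
  | zero =>
    intro p hn hσ hτ
    exact ⟨p, hσ, hτ, (Set.ncard_eq_zero (hV.subset Set.sdiff_subset)).1 hn⟩
  | succ n ih =>
    intro p hn hσ hτ
    have hfree : (p.free H).Nonempty := by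
      rw [Set.nonempty_iff_ne_empty]
      rintro h
      simp [h] at hn
    have hcard {v : α} (hv : v ∈ p.free H) : ((p.claim v).free H).ncard = n := by
      rw [Position.free_claim, Set.ncard_sdiff_singleton_of_mem hv, hn, Nat.add_sub_cancel]
    cases hturn : p.turn with
    | maker =>
      exact ih _ (hcard (σ p hfree).2) (.own hσ hturn hfree) (.opponent hτ hturn (σ p hfree).2)
    | breaker =>
      exact ih _ (hcard (τ p hfree).2) (.opponent hσ hturn (τ p hfree).2) (.own hτ hturn hfree)

theorem BreakerWins.not_makerWins {H : Hypergraph α} {first : Player} (hV : V(H).Finite)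
    (h : BreakerWins H first) : ¬ MakerWins H first := by
  rintro ⟨σ, hσ⟩
  obtain ⟨τ, hτ⟩ := h
  obtain ⟨p, hpσ, hpτ, hfree⟩ := exists_reachable_free_eq_empty hV σ τ first
  obtain ⟨e, he, hsub⟩ := hσ p hpσ hfree
  exact hτ p hpτ e he hsub

/-! ### Pairing strategies and the degree bound -/

/-- The hypergraph of all `n`-subsets of a type. -/
def completeUniform (α : Type*) (n : ℕ) : Hypergraph α where
  vertexSet := Set.univ
  edgeSet := {e | e.ncard = n}
  subset_vertexSet_of_mem_edgeSet' := fun _ _ => Set.subset_univ _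

/-- Moving first, Maker ends with at least half of the vertices, however he plays. This makes the
set defining `f n` nonempty, so that its `sInf` is attained and is not the default value 0. -/
theorem makerWins_completeUniform {α : Type*} [Finite α] {n : ℕ} (hn : 2 * n ≤ Nat.card α + 1) :
    MakerWins (completeUniform α n) .maker := by
  refine ⟨fun p hfree => ⟨hfree.some, hfree.some_mem⟩, fun p hp hfree => ?_⟩
  have hcard : (p.turn = .maker ∧ p.breaker.ncard ≤ p.maker.ncard) ∨
      (p.turn = .breaker ∧ p.breaker.ncard + 1 ≤ p.maker.ncard) := by
    have hclaim (p : Position α) (v : α) (hv : v ∈ p.free (completeUniform α n))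
        (h : (p.turn = .maker ∧ p.breaker.ncard ≤ p.maker.ncard) ∨
          (p.turn = .breaker ∧ p.breaker.ncard + 1 ≤ p.maker.ncard)) :
        ((p.claim v).turn = .maker ∧ (p.claim v).breaker.ncard ≤ (p.claim v).maker.ncard) ∨
          ((p.claim v).turn = .breaker ∧
            (p.claim v).breaker.ncard + 1 ≤ (p.claim v).maker.ncard) := by
      obtain ⟨M, B, t⟩ := p
      cases t with
      | maker =>
        have hM : (insert v M).ncard = M.ncard + 1 :=
          Set.ncard_insert_of_notMem fun h => hv.2 (.inl h)
        right
        simpa [Position.claim, hM] using h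
      | breaker =>
        left
        have hB := Set.ncard_insert_le v B
        simp only [reduceCtorEq, false_and, true_and, false_or] at h
        exact ⟨rfl, hB.trans h⟩
    clear hfree
    induction hp with
    | start => exact .inl ⟨rfl, by simp [Position.start]⟩
    | own _ _ hfree ih => exact hclaim _ _ hfree.some_mem ih
    | opponent _ _ hv ih => exact hclaim _ _ hv ih
  have huniv : p.maker ∪ p.breaker = Set.univ :=
    Set.univ_subset_iff.1 (Set.sdiff_eq_empty.1 hfree)
  have hle := Set.ncard_union_le p.maker p.breaker
  rw [huniv, Set.ncard_univ] at hle
  obtain ⟨e, hsub, he⟩ := Set.exists_subset_card_eq (s := p.maker) (n := n) (by omega)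
  exact ⟨e, he, hsub⟩

/-- A system of pairs of vertices, one pair inside every edge, gives Breaker a pairing strategy. -/
theorem breakerWins_of_pairing {H : Hypergraph α} (φ : E(H) × Bool → α)
    (hφ : Function.Injective φ) (hmem : ∀ e k, φ (e, k) ∈ e.1) : BreakerWins H .maker := by
  classical
  have hV (q : E(H) × Bool) : φ q ∈ V(H) :=
    H.subset_vertexSet_of_mem_edgeSet q.1.2 (hmem q.1 q.2)
  have hne (e : E(H)) (k : Bool) : φ (e, !k) ≠ φ (e, k) := fun h => by simpa using hφ h
  let reply (p : Position α) (u : α) : Prop :=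
    u ∈ p.free H ∧ ∃ e k, φ (e, k) ∈ p.maker ∧ u = φ (e, !k)
  let σ : Strategy H := fun p hfree =>
    if hp : ∃ u, reply p u then ⟨hp.choose, hp.choose_spec.1⟩
    else ⟨hfree.some, hfree.some_mem⟩
  have hσ (p : Position α) (hfree : (p.free H).Nonempty) (hp : ∃ u, reply p u) :
      reply p (σ p hfree).1 := by
    simp only [σ, dif_pos hp]
    exact hp.choose_spec
  -- Invariant: when Maker is to move, every paired vertex of his has its partner with Breaker; when
  -- Breaker is to move, the only possible exception is Maker's last vertex `v`.
  have key {p : Position α} (hp : Reachable H .breaker σ .maker p) :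
      Disjoint p.maker p.breaker ∧
      ((p.turn = .maker ∧ ∀ e k, φ (e, k) ∈ p.maker → φ (e, !k) ∈ p.breaker) ∨
        (p.turn = .breaker ∧ ∃ v, ∀ e k, φ (e, k) ∈ p.maker →
          φ (e, !k) ∈ p.breaker ∨ (φ (e, k) = v ∧ φ (e, !k) ∉ p.maker))) := by
    induction hp with
    | start => exact ⟨Set.disjoint_empty _, .inl ⟨rfl, fun e k h => h.elim⟩⟩
    | @own p _ hturn hfree ih =>
      have hfr := (σ p hfree).2
      have hrep := hσ p hfree
      generalize (σ p hfree).1 = u at hfr hrep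
      obtain ⟨M, B, t⟩ := p
      obtain rfl : t = .breaker := hturn
      obtain ⟨hdisj, ⟨h, -⟩ | ⟨-, v, hv⟩⟩ := ih
      · cases h
      refine ⟨Set.disjoint_insert_right.2 ⟨fun h => hfr.2 (.inl h), hdisj⟩, .inl ⟨rfl, ?_⟩⟩
      intro e k hM
      rcases hv e k hM with hB | ⟨hev, hnM⟩
      · exact .inr hB
      by_cases hB : φ (e, !k) ∈ B
      · exact .inr hB
      have hex : ∃ u, reply ⟨M, B, .breaker⟩ u :=
        ⟨φ (e, !k), ⟨hV _, by rintro (h | h); exacts [hnM h, hB h]⟩, e, k, hM, rfl⟩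
      obtain ⟨hu, e', k', hM', rfl⟩ := hrep hex
      rcases hv e' k' hM' with hB' | ⟨hev', -⟩
      · exact (hu.2 (.inr hB')).elim
      · have := hφ (hev.trans hev'.symm)
        simp only [Prod.mk.injEq] at this
        obtain ⟨rfl, rfl⟩ := this
        exact .inl rfl
    | @opponent p _ hturn v hv ih =>
      obtain ⟨M, B, t⟩ := p
      obtain rfl : t = .maker := hturn
      obtain ⟨hdisj, ⟨-, h⟩ | ⟨h, -⟩⟩ := ih
      swap
      · cases h
      refine ⟨Set.disjoint_insert_left.2 ⟨fun h => hv.2 (.inr h), hdisj⟩, .inr ⟨rfl, v, ?_⟩⟩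
      rintro e k (rfl | hM)
      · refine .inr ⟨rfl, ?_⟩
        rintro (h' | h')
        · exact hne e k h'
        · have := h e (!k) h'
          rw [Bool.not_not] at this
          exact hv.2 (.inr this)
      · exact .inl (h e k hM)
  refine ⟨σ, fun p hp e he hsub => ?_⟩
  obtain ⟨hdisj, h⟩ := key hp
  have hin (k : Bool) : φ (⟨e, he⟩, k) ∈ p.maker := hsub (hmem ⟨e, he⟩ k)
  have hnot (k : Bool) : φ (⟨e, he⟩, k) ∉ p.breaker := fun hb => hdisj.le_bot ⟨hin k, hb⟩
  rcases h with ⟨-, h⟩ | ⟨-, v, h⟩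
  · exact hnot _ (h _ true (hin true))
  · rcases h _ true (hin true) with h | ⟨-, h⟩
    · exact hnot _ h
    · exact h (hin _)

theorem _root_.Hypergraph.degree_le_maxDegree {H : Hypergraph α} (hV : V(H).Finite) {v : α}
    (hv : v ∈ V(H)) : H.degree v ≤ H.maxDegree :=
  le_csSup (hV.image _).bddAbove (Set.mem_image_of_mem _ hv)

theorem _root_.Hypergraph.finite_edgeSet {H : Hypergraph α} (hV : V(H).Finite) : E(H).Finite :=
  hV.finite_subsets.subset fun _ he => H.subset_vertexSet_of_mem_edgeSet he

/-- Double counting of incidences. -/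
theorem _root_.Hypergraph.IsUniform.card_mul_le {H : Hypergraph α} {n : ℕ} (hH : H.IsUniform n)
    (hV : V(H).Finite) (T : Finset E(H)) (U : Finset α) (hU : ∀ e ∈ T, e.1 ⊆ U) :
    T.card * n ≤ U.card * H.maxDegree := by
  classical
  refine Finset.card_mul_le_card_mul (fun (e : E(H)) v => v ∈ e.1) (fun e he => ?_)
    (fun v _ => ?_)
  · rw [← hH e.1 e.2, ← Set.ncard_coe_finset]
    refine Set.ncard_le_ncard (fun v hv => ?_) (Finset.finite_toSet _)
    simpa [Finset.mem_bipartiteAbove] using ⟨hU e he hv, hv⟩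
  · by_cases hv : v ∈ V(H)
    · refine le_trans ?_ (H.degree_le_maxDegree hV hv)
      rw [← Set.ncard_coe_finset, ← Set.ncard_image_of_injective _ Subtype.val_injective]
      refine Set.ncard_le_ncard ?_ ((H.finite_edgeSet hV).subset fun e he => he.1)
      rintro _ ⟨e, he, rfl⟩
      simp only [Finset.mem_coe, Finset.mem_bipartiteBelow] at he
      exact ⟨e.2, he.2⟩
    · rw [Finset.card_eq_zero.2]
      · exact Nat.zero_le _
      · refine Finset.eq_empty_of_forall_notMem fun e he => hv ?_
        rw [Finset.mem_bipartiteBelow] at he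
        exact H.subset_vertexSet_of_mem_edgeSet e.2 he.2

/-- Hall's theorem with each edge taken twice, the `Bool` naming the copy: `k` edges spanning `u`
vertices satisfy `k * n ≤ u * maxDegree`, hence `2 * k ≤ u`. -/
theorem breakerWins_of_maxDegree_le {H : Hypergraph α} {n : ℕ} (hn : 1 ≤ n) (hV : V(H).Finite)
    (hH : H.IsUniform n) (hdeg : 2 * H.maxDegree ≤ n) : BreakerWins H .maker := by
  classical
  have hfin (e : E(H)) : e.1.Finite := hV.subset (H.subset_vertexSet_of_mem_edgeSet e.2)
  let t : E(H) × Bool → Finset α := fun q => (hfin q.1).toFinset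
  have hall : ∀ s : Finset (E(H) × Bool), s.card ≤ (s.biUnion t).card := by
    intro s
    have h1 : s.card ≤ 2 * (s.image Prod.fst).card := by
      have hsub : s ⊆ (s.image Prod.fst) ×ˢ (Finset.univ : Finset Bool) := by
        intro q hq
        simpa only [Finset.mem_product, Finset.mem_univ, and_true] using
          Finset.mem_image_of_mem _ hq
      simpa [mul_comm] using Finset.card_le_card hsub
    have h2 := hH.card_mul_le hV (s.image Prod.fst) (s.biUnion t) (by
      intro e he v hv
      obtain ⟨q, hq, rfl⟩ := Finset.mem_image.1 he
      simp only [Finset.coe_biUnion, Set.mem_iUnion]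
      exact ⟨q, hq, by simpa [t] using hv⟩)
    have h3 : 2 * (s.image Prod.fst).card * n ≤ (s.biUnion t).card * n := by
      nlinarith [Nat.mul_le_mul_left (s.biUnion t).card hdeg]
    exact h1.trans (Nat.le_of_mul_le_mul_right h3 hn)
  obtain ⟨φ, hφ, hmem⟩ := (Finset.all_card_le_biUnion_card_iff_exists_injective t).1 hall
  exact breakerWins_of_pairing φ hφ fun e k => (hfin e).mem_toFinset.1 (hmem (e, k))

theorem half_lt_f {n : ℕ} (hn : 1 ≤ n) : n < 2 * f n := by
  have hne : {d : ℕ | ∃ (α : Type) (H : Hypergraph α), V(H).Finite ∧ H.IsUniform n ∧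
      H.maxDegree ≤ d ∧ MakerWins H .maker}.Nonempty :=
    ⟨_, Fin (2 * n), completeUniform _ n, Set.toFinite _, fun _ he => he, le_rfl,
      makerWins_completeUniform (by simp)⟩
  obtain ⟨α, H, hV, hH, hdeg, hwin⟩ := Nat.sInf_mem hne
  by_contra! hlt
  exact (breakerWins_of_maxDegree_le hn hV hH
    ((Nat.mul_le_mul_left 2 hdeg).trans hlt)).not_makerWins hV hwin

/-! ### Size, uniformity and degrees of `G₄` -/

open GammaPrimeVertex G4Vertex

/-- The `4`-edges of `G₄` in the gadget which replaces `w_i x_{ij} t_{ij}` in the `a`-th copy. -/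
def gadgetEdge (a : Fin 3) (i : Fin 5) (j : Fin 3) : Fin 7 → Finset G4Vertex :=
  ![{copy a (old (.w i)), copy a (old (.t i j)), copy a (y i j 0), copy a (y i j 1)},
    {copy a (old (.x i j)), copy a (old (.t i j)), copy a (y i j 2), copy a (y i j 3)},
    {copy a (old (.x i j)), copy a (old (.t i j)), copy a (y i j 4), copy a (y i j 5)},
    {copy a (y i j 0), copy a (y i j 2), copy a (y i j 4), copy a (z i j 0)},
    {copy a (y i j 0), copy a (y i j 2), copy a (y i j 4), copy a (z i j 1)},
    {copy a (y i j 1), copy a (y i j 3), copy a (y i j 5), copy a (z i j 2)},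
    {copy a (y i j 1), copy a (y i j 3), copy a (y i j 5), copy a (z i j 3)}]

/-- The edge `e_i` of the `a`-th copy together with its apex. -/
def coreEdge (a : Fin 3) (i : Fin 5) : Finset G4Vertex :=
  {apex a i, copy a (old (.x i 0)), copy a (old (.x (i + 2) 1)), copy a (old (.x (i + 3) 2))}

/-- The edge `v_1 v_2 v_3 v_4` of `G₄`. -/
def topEdge : Finset G4Vertex := {.v 0, .v 1, .v 2, .v 3}

/-- Ensures that the condition `e₀ ≠ core i` in the definition of `G4` discards no gadget edge. -/
theorem exists_notMem_range_old {i : Fin 5} {j : Fin 3} {e : Set GammaPrimeVertex}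
    (he : e ∈ gadget i j) : ∃ u ∈ e, u ∉ Set.range old := by
  simp only [gadget, Set.mem_insert_iff, Set.mem_singleton_iff] at he
  rcases he with rfl | rfl | rfl | rfl | rfl | rfl | rfl
  · exact ⟨y i j 0, by simp⟩
  · exact ⟨y i j 2, by simp⟩
  · exact ⟨y i j 4, by simp⟩
  · exact ⟨y i j 0, by simp⟩
  · exact ⟨y i j 0, by simp⟩
  · exact ⟨y i j 1, by simp⟩
  · exact ⟨y i j 1, by simp⟩

theorem image_copy_gadget (a : Fin 3) (i : Fin 5) (j : Fin 3) (e : Set G4Vertex) :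
    (∃ e₀ ∈ gadget i j, e = copy a '' e₀) ↔ ∃ k, e = gadgetEdge a i j k := by
  simp [gadget, gadgetEdge, Fin.exists_fin_succ, Set.image_insert_eq]

theorem mem_edgeSet_G4 {e : Set G4Vertex} :
    e ∈ E(G4) ↔ (∃ a i j k, e = gadgetEdge a i j k) ∨ (∃ a i, e = coreEdge a i) ∨ e = topEdge := by
  have hcore (a : Fin 3) (i : Fin 5) :
      insert (apex a i) (copy a '' GammaPrimeVertex.core i) = (coreEdge a i : Set G4Vertex) := by
    simp [coreEdge, GammaPrimeVertex.core, GammaVertex.core, Set.image_insert_eq]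
  have htop : ({.v 0, .v 1, .v 2, .v 3} : Set G4Vertex) = topEdge := by simp [topEdge]
  have hmain : (∃ a, ∃ e₀ ∈ E(GammaPrime), (∀ i, e₀ ≠ GammaPrimeVertex.core i) ∧
      e = copy a '' e₀) ↔ ∃ a i j k, e = gadgetEdge a i j k := by
    simp only [← image_copy_gadget]
    constructor
    · rintro ⟨a, e₀, ⟨e₁, he₁, hns, rfl⟩ | ⟨i, j, he₀⟩, hnc, rfl⟩
      · rcases he₁ with ⟨i, j, rfl⟩ | ⟨i, rfl⟩
        · exact (hns i j rfl).elim
        · exact (hnc i rfl).elim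
      · exact ⟨a, i, j, e₀, he₀, rfl⟩
    · rintro ⟨a, i, j, e₀, he₀, rfl⟩
      refine ⟨a, e₀, .inr ⟨i, j, he₀⟩, ?_, rfl⟩
      rintro c rfl
      obtain ⟨u, hu, hold⟩ := exists_notMem_range_old he₀
      exact hold (Set.image_subset_range _ _ hu)
  change (_ ∨ _) ∨ _ ↔ _
  rw [or_assoc]
  refine or_congr hmain (or_congr ?_ ?_)
  · simp only [Set.mem_ofPred_eq, hcore]
  · rw [Set.mem_singleton_iff, htop]

theorem gadgetEdge_mem (a : Fin 3) (i : Fin 5) (j : Fin 3) (k : Fin 7) :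
    (gadgetEdge a i j k : Set G4Vertex) ∈ E(G4) := mem_edgeSet_G4.2 (.inl ⟨a, i, j, k, rfl⟩)

theorem coreEdge_mem (a : Fin 3) (i : Fin 5) : (coreEdge a i : Set G4Vertex) ∈ E(G4) :=
  mem_edgeSet_G4.2 (.inr (.inl ⟨a, i, rfl⟩))

theorem topEdge_mem : (topEdge : Set G4Vertex) ∈ E(G4) := mem_edgeSet_G4.2 (.inr (.inr rfl))

theorem isUniform_G4 : G4.IsUniform 4 := by
  intro e he
  rcases mem_edgeSet_G4.1 he with ⟨a, i, j, k, rfl⟩ | ⟨a, i, rfl⟩ | rfl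
  · rw [Set.ncard_coe_finset]
    fin_cases k <;> simp [gadgetEdge]
  · rw [Set.ncard_coe_finset]
    clear he
    revert a i
    decide
  · rw [Set.ncard_coe_finset]
    decide

theorem ncard_vertexSet_G4 : V(G4).ncard = 562 := by
  change (Set.univ : Set G4Vertex).ncard = 562
  rw [Set.ncard_univ, Nat.card_eq_fintype_card]
  decide +kernel

/-- The edges of `G₄`, indexed by a type. -/
def edgeOf : (Fin 3 × Fin 5 × Fin 3 × Fin 7) ⊕ (Fin 3 × Fin 5) ⊕ Unit → Finset G4Vertex
  | .inl (a, i, j, k) => gadgetEdge a i j k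
  | .inr (.inl (a, i)) => coreEdge a i
  | .inr (.inr ()) => topEdge

theorem range_edgeOf : Set.range (fun q => (edgeOf q : Set G4Vertex)) = E(G4) := by
  ext e
  rw [mem_edgeSet_G4]
  simp [edgeOf, eq_comm]

theorem gadgetEdge_injective (a : Fin 3) (i : Fin 5) (j : Fin 3) :
    Function.Injective (gadgetEdge a i j) := by
  revert a i j
  unfold Function.Injective
  decide +kernel

/-- A gadget edge contains some `y`, which identifies its gadget and occurs in no other kind of
edge; a core edge is identified by its vertex `x i 0`. -/
theorem edgeOf_injective : Function.Injective edgeOf := by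
  have hy (a i j k) : ∃ l, copy a (y i j l) ∈ gadgetEdge a i j k := by
    fin_cases k
    exacts [⟨0, by simp [gadgetEdge]⟩, ⟨2, by simp [gadgetEdge]⟩, ⟨4, by simp [gadgetEdge]⟩,
      ⟨0, by simp [gadgetEdge]⟩, ⟨0, by simp [gadgetEdge]⟩, ⟨1, by simp [gadgetEdge]⟩,
      ⟨1, by simp [gadgetEdge]⟩]
  have hy' {a i j l a' i' j' k'} (h : copy a (y i j l) ∈ gadgetEdge a' i' j' k') :
      a = a' ∧ i = i' ∧ j = j' := by
    fin_cases k' <;> simp [gadgetEdge] at h <;> tauto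
  have hcore {a i j l a' i'} : copy a (y i j l) ∉ coreEdge a' i' := by
    simp only [coreEdge, apex]
    split_ifs <;> simp
  have htop {a u} : copy a u ∉ topEdge := by simp [topEdge]
  have hx (a i) : copy a (old (.x i 0)) ∈ coreEdge a i := by simp [coreEdge]
  rintro (⟨a, i, j, k⟩ | ⟨a, i⟩ | ⟨⟩) (⟨a', i', j', k'⟩ | ⟨a', i'⟩ | ⟨⟩) h <;>
    simp only [edgeOf] at h
  · obtain ⟨l, hl⟩ := hy a i j k
    obtain ⟨rfl, rfl, rfl⟩ := hy' (h ▸ hl)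
    rw [gadgetEdge_injective a i j h]
  · obtain ⟨l, hl⟩ := hy a i j k
    exact (hcore (h ▸ hl)).elim
  · obtain ⟨l, hl⟩ := hy a i j k
    exact (htop (h ▸ hl)).elim
  · obtain ⟨l, hl⟩ := hy a' i' j' k'
    exact (hcore (h ▸ hl)).elim
  · have h' := hx a i
    rw [h] at h'
    simp only [coreEdge, apex] at h'
    split_ifs at h' <;> simp at h' <;> simp [h']
  · exact (htop (h ▸ hx a i)).elim
  · obtain ⟨l, hl⟩ := hy a' i' j' k'
    exact (htop (h ▸ hl)).elim
  · exact (htop (h ▸ hx a' i')).elim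
  · rfl

theorem ncard_edgeSet_G4 : E(G4).ncard = 331 := by
  have hinj : Function.Injective fun q => (edgeOf q : Set G4Vertex) :=
    Finset.coe_injective.comp edgeOf_injective
  rw [← range_edgeOf, ← Set.image_univ, Set.ncard_image_of_injective _ hinj, Set.ncard_univ,
    Nat.card_eq_fintype_card]
  decide +kernel

theorem degree_G4_le (u : G4Vertex) : G4.degree u ≤ 3 := by
  have key (e₁ e₂ e₃ : Finset G4Vertex) (h : ∀ q, u ∈ edgeOf q →
      edgeOf q = e₁ ∨ edgeOf q = e₂ ∨ edgeOf q = e₃) : G4.degree u ≤ 3 := by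
    have hsub : {e | e ∈ E(G4) ∧ u ∈ e} ⊆ {(e₁ : Set G4Vertex), ↑e₂, ↑e₃} := by
      rintro e ⟨he, hu⟩
      rw [← range_edgeOf] at he
      obtain ⟨q, rfl⟩ := he
      simpa using h q (by simpa using hu)
    refine (Set.ncard_le_ncard hsub (Set.toFinite _)).trans ?_
    refine (Set.ncard_insert_le _ _).trans (Nat.succ_le_succ ?_)
    exact (Set.ncard_insert_le _ _).trans (by simp)
  rcases u with ⟨a, (⟨i⟩ | ⟨i, j⟩ | ⟨i, j⟩) | ⟨i, j, l⟩ | ⟨i, j, l⟩⟩ | b | a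
  · refine key (gadgetEdge a i 0 0) (gadgetEdge a i 1 0) (gadgetEdge a i 2 0) ?_
    rintro (⟨a', i', j', k'⟩ | ⟨a', i'⟩ | ⟨⟩) h
    · fin_cases k' <;> simp [edgeOf, gadgetEdge] at h
      obtain ⟨rfl, rfl⟩ := h
      fin_cases j' <;> simp [edgeOf]
    · simp [edgeOf, coreEdge, apex] at h
      split_ifs at h
    · simp [edgeOf, topEdge] at h
  -- The shifts 0, 2, 3 in `e_c` are undone to find the core edge through `x i j`.
  · refine key (gadgetEdge a i j 1) (gadgetEdge a i j 2) (coreEdge a (![i, i - 2, i - 3] j)) ?_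
    rintro (⟨a', i', j', k'⟩ | ⟨a', i'⟩ | ⟨⟩) h
    · fin_cases k' <;> simp [edgeOf, gadgetEdge] at h <;> obtain ⟨rfl, rfl, rfl⟩ := h <;>
        simp [edgeOf]
    · simp only [edgeOf, coreEdge, apex, Finset.mem_insert, Finset.mem_singleton] at h
      rcases h with h | h | h | h
      · split_ifs at h
      all_goals
        simp only [copy.injEq, old.injEq, GammaVertex.x.injEq] at h
        obtain ⟨rfl, rfl, rfl⟩ := h
        simp [edgeOf]
    · simp [edgeOf, topEdge] at h
  · refine key (gadgetEdge a i j 0) (gadgetEdge a i j 1) (gadgetEdge a i j 2) ?_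
    rintro (⟨a', i', j', k'⟩ | ⟨a', i'⟩ | ⟨⟩) h
    · fin_cases k' <;> simp [edgeOf, gadgetEdge] at h <;> obtain ⟨rfl, rfl, rfl⟩ := h <;>
        simp [edgeOf]
    · simp [edgeOf, coreEdge, apex] at h
      split_ifs at h
    · simp [edgeOf, topEdge] at h
  · refine key (gadgetEdge a i j (![0, 0, 1, 1, 2, 2] l))
      (gadgetEdge a i j (![3, 5, 3, 5, 3, 5] l)) (gadgetEdge a i j (![4, 6, 4, 6, 4, 6] l)) ?_
    rintro (⟨a', i', j', k'⟩ | ⟨a', i'⟩ | ⟨⟩) h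
    · fin_cases k' <;> simp [edgeOf, gadgetEdge] at h <;>
        obtain ⟨rfl, rfl, rfl⟩ : a = a' ∧ i = i' ∧ j = j' := by tauto
      all_goals fin_cases l <;> simp [edgeOf] at h ⊢
    · simp [edgeOf, coreEdge, apex] at h
      split_ifs at h
    · simp [edgeOf, topEdge] at h
  · refine key (gadgetEdge a i j (![3, 4, 5, 6] l)) ∅ ∅ ?_
    rintro (⟨a', i', j', k'⟩ | ⟨a', i'⟩ | ⟨⟩) h
    · fin_cases k' <;> simp [edgeOf, gadgetEdge] at h <;> obtain ⟨rfl, rfl, rfl, rfl⟩ := h <;>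
        simp [edgeOf]
    · simp [edgeOf, coreEdge, apex] at h
      split_ifs at h
    · simp [edgeOf, topEdge] at h
  -- The last entry 2 is a filler: `v 3` lies in `topEdge` only.
  · refine key (coreEdge (![0, 1, 2, 2] b) 0) (coreEdge (![0, 1, 2, 2] b) 1) topEdge ?_
    rintro (⟨a', i', j', k'⟩ | ⟨a', i'⟩ | ⟨⟩) h
    · fin_cases k' <;> simp [edgeOf, gadgetEdge] at h
    · simp only [edgeOf, coreEdge, apex, Finset.mem_insert, Finset.mem_singleton, reduceCtorEq,
        or_false] at h
      split_ifs at h with hi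
      obtain rfl := G4Vertex.v.inj h
      have ha : (![0, 1, 2, 2] : Fin 4 → Fin 3) a'.castSucc = a' := by
        fin_cases a' <;> rfl
      rw [ha]
      rcases hi with rfl | rfl <;> simp [edgeOf]
    · simp [edgeOf]
  · refine key (coreEdge a 2) (coreEdge a 3) (coreEdge a 4) ?_
    rintro (⟨a', i', j', k'⟩ | ⟨a', i'⟩ | ⟨⟩) h
    · fin_cases k' <;> simp [edgeOf, gadgetEdge] at h
    · simp only [edgeOf, coreEdge, apex, Finset.mem_insert, Finset.mem_singleton, reduceCtorEq,
        or_false] at h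
      split_ifs at h with hi
      obtain rfl := G4Vertex.s.inj h
      fin_cases i' <;> simp [edgeOf] at hi ⊢
    · simp [edgeOf, topEdge] at h

theorem maxDegree_G4 : G4.maxDegree = 3 := by
  refine le_antisymm (csSup_le' ?_) ?_
  · rintro _ ⟨u, -, rfl⟩
    exact degree_G4_le u
  -- Degree 3 is attained at a vertex `t`, which lies in the first three edges of its gadget.
  · refine le_trans ?_ (G4.degree_le_maxDegree (Set.toFinite _)
      (Set.mem_univ (copy 0 (old (.t 0 0)))))
    have hinj : Function.Injective fun k => (gadgetEdge 0 0 0 k : Set G4Vertex) :=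
      Finset.coe_injective.comp (gadgetEdge_injective 0 0 0)
    have hcard : ((fun k => (gadgetEdge 0 0 0 k : Set G4Vertex)) '' {0, 1, 2}).ncard = 3 := by
      rw [Set.ncard_image_of_injective _ hinj, Set.ncard_eq_three]
      exact ⟨0, 1, 2, by decide, by decide, by decide, rfl⟩
    refine hcard.symm.le.trans (Set.ncard_le_ncard ?_ ?_)
    swap
    · exact (G4.finite_edgeSet (Set.toFinite _)).subset fun e he => he.1
    rintro _ ⟨k, hk, rfl⟩
    refine ⟨gadgetEdge_mem 0 0 0 k, ?_⟩
    rcases hk with rfl | rfl | rfl <;> simp [gadgetEdge]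

/-! ### Maker's win on `G₄` -/

/-- The index of the gadget containing a vertex of `Γ'` other than the `w_i`. -/
def gadgetIndex : GammaPrimeVertex → Option (Fin 5 × Fin 3)
  | old (.w _) => none
  | old (.x i j) => some (i, j)
  | old (.t i j) => some (i, j)
  | y i j _ => some (i, j)
  | z i j _ => some (i, j)

/-- The first indices of the vertices of `e_i` are `i`, `i + 2`, `i + 3`. -/
def coreShift : Fin 3 → Fin 5 := ![0, 2, 3]

/-- The index of the edge `e_c` that meets the gadget of a vertex. -/
def coreIndex (u : GammaPrimeVertex) : Option (Fin 5) :=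
  (gadgetIndex u).map fun p => p.1 - coreShift p.2

/-- Claiming `p 0` forces `q 0`, claiming `p 1` forces `q 1`, and `p 2` then threatens both `r` and
`r'`. The vertex `q 2` is never needed, so it may already be Breaker's. -/
theorem Wins.of_half_gadget {α : Type*} {E : Set (Set α)} {M B : Set α} {p q : Fin 3 → α}
    {r r' : α} (hpq : ∀ k, ∃ e ∈ E, e ⊆ {p k, q k} ∪ M) (hr : {p 0, p 1, p 2, r} ∈ E)
    (hr' : {p 0, p 1, p 2, r'} ∈ E) (hB : Disjoint {p 0, p 1, p 2, q 0, q 1, r, r'} B)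
    (hnodup : [p 0, p 1, p 2, q 0, q 1, r, r'].Nodup) : Wins E M B := by
  obtain ⟨e₀, he₀, hs₀⟩ := hpq 0
  obtain ⟨e₁, he₁, hs₁⟩ := hpq 1
  simp only [Set.disjoint_insert_left, Set.disjoint_singleton_left] at hB
  simp only [List.nodup_cons, List.mem_cons, List.not_mem_nil, or_false, not_or] at hnodup
  obtain ⟨hp₀, hp₁, hp₂, hq₀, hq₁, hr₁, hr₂⟩ := hB
  refine .force he₀ hp₀ hq₀ (hs₀.trans ?_) (.force (m := p 1) (b := q 1) he₁ ?_ ?_ (hs₁.trans ?_)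
    (.double (m := p 2) hr hr' ?_ (b := r) (b' := r') ?_ ?_ ?_ ?_ ?_))
  · intro u
    simp only [Set.mem_union, Set.mem_insert_iff, Set.mem_singleton_iff]
    tauto
  · simp only [Set.mem_insert_iff]; tauto
  · simp only [Set.mem_insert_iff]; tauto
  · intro u
    simp only [Set.mem_union, Set.mem_insert_iff, Set.mem_singleton_iff]
    tauto
  · simp only [Set.mem_insert_iff]; tauto
  · simp only [Set.mem_insert_iff]; tauto
  · simp only [Set.mem_insert_iff]; tauto
  · tauto
  · intro u
    simp only [Set.mem_insert_iff, Set.mem_singleton_iff]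
    tauto
  · intro u
    simp only [Set.mem_insert_iff, Set.mem_singleton_iff]
    tauto

variable {a : Fin 3} {M B : Set G4Vertex}

/-- With `w`, `x`, `t` claimed, the first three edges become the pairs `y 0 y 1`, `y 2 y 3`, `y 4 y
5`. The even and the odd `y` form two halves to which `of_half_gadget` applies, and a single Breaker
move cannot spoil both. -/
theorem wins_of_gadget {i : Fin 5} {j : Fin 3} (hw : copy a (old (.w i)) ∈ M)
    (hx : copy a (old (.x i j)) ∈ M) (ht : copy a (old (.t i j)) ∈ M)
    (hy : ∀ k, copy a (y i j k) ∉ B) (hz : ∀ k, copy a (z i j k) ∉ B) (b : G4Vertex) :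
    Wins E(G4) M (insert b B) := by
  have hE (k : Fin 7) := gadgetEdge_mem a i j k
  have h0 := hE 0
  have h1 := hE 1
  have h2 := hE 2
  have h3 := hE 3
  have h4 := hE 4
  have h5 := hE 5
  have h6 := hE 6
  simp [gadgetEdge] at h0 h1 h2 h3 h4 h5 h6
  have pair {p q : G4Vertex} {c : G4Vertex} (hc : c ∈ M)
      (h : {c, copy a (old (.t i j)), p, q} ∈ E(G4)) :
      ∃ e ∈ E(G4), e ⊆ {p, q} ∪ M := by
    refine ⟨_, h, ?_⟩
    rintro u (rfl | rfl | h)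
    exacts [.inr hc, .inr ht, .inl h]
  have pair' {p q : G4Vertex} (h : ∃ e ∈ E(G4), e ⊆ {p, q} ∪ M) :
      ∃ e ∈ E(G4), e ⊆ {q, p} ∪ M := by rwa [Set.pair_comm]
  have p0 := pair hw h0
  have p1 := pair hx h1
  have p2 := pair hx h2
  have rot {p q r s : G4Vertex} (h : {p, q, r, s} ∈ E(G4)) : {q, r, p, s} ∈ E(G4) := by
    convert h using 1
    ext u
    simp only [Set.mem_insert_iff, Set.mem_singleton_iff]
    tauto
  have dis (A : Set G4Vertex)
      (hA : ∀ u ∈ A, (∃ k, u = copy a (y i j k)) ∨ ∃ k, u = copy a (z i j k)) (hb : b ∉ A) :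
      Disjoint A (insert b B) := by
    rw [Set.disjoint_insert_right]
    refine ⟨hb, Set.disjoint_left.2 fun u hu huB => ?_⟩
    rcases hA u hu with ⟨k, rfl⟩ | ⟨k, rfl⟩
    exacts [hy k huB, hz k huB]
  have swap {p q r s : G4Vertex} (h : {p, q, r, s} ∈ E(G4)) : {p, r, q, s} ∈ E(G4) := by
    rwa [Set.insert_comm r q]
  have line {p₀ p₁ p₂ q₀ q₁ q₂ r r' : G4Vertex} (h₀ : ∃ e ∈ E(G4), e ⊆ {p₀, q₀} ∪ M)
      (h₁ : ∃ e ∈ E(G4), e ⊆ {p₁, q₁} ∪ M) (h₂ : ∃ e ∈ E(G4), e ⊆ {p₂, q₂} ∪ M)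
      (hr : {p₀, p₁, p₂, r} ∈ E(G4)) (hr' : {p₀, p₁, p₂, r'} ∈ E(G4))
      (hA : ∀ u ∈ ({p₀, p₁, p₂, q₀, q₁, r, r'} : Set G4Vertex),
        (∃ k, u = copy a (y i j k)) ∨ ∃ k, u = copy a (z i j k))
      (hb : b ∉ ({p₀, p₁, p₂, q₀, q₁, r, r'} : Set G4Vertex))
      (hnodup : [p₀, p₁, p₂, q₀, q₁, r, r'].Nodup) : Wins E(G4) M (insert b B) :=
    .of_half_gadget (p := ![p₀, p₁, p₂]) (q := ![q₀, q₁, q₂])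
      (by simpa [Fin.forall_fin_succ] using ⟨h₀, h₁, h₂⟩) hr hr' (dis _ hA hb) hnodup
  -- Use a half whose three `y`s and two `z`s avoid `b`, ordering the pairs so that `b`, if it is a
  -- partner, becomes the harmless `q₂`.
  by_cases hb₁ : b = copy a (y i j 1)
  · exact line p1 p2 p0 (rot h3) (rot h4) (by simp) (by simp [hb₁]) (by simp)
  by_cases hb₃ : b = copy a (y i j 3)
  · exact line p0 p2 p1 (swap h3) (swap h4) (by simp) (by simp [hb₃]) (by simp)
  by_cases hb₀ : b = copy a (y i j 0)
  · exact line (pair' p1) (pair' p2) (pair' p0) (rot h5) (rot h6) (by simp) (by simp [hb₀])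
      (by simp)
  by_cases hb₂ : b = copy a (y i j 2)
  · exact line (pair' p0) (pair' p2) (pair' p1) (swap h5) (swap h6) (by simp) (by simp [hb₂])
      (by simp)
  by_cases hb' : b = copy a (y i j 4) ∨ b = copy a (z i j 0) ∨ b = copy a (z i j 1)
  · exact line (pair' p0) (pair' p1) (pair' p2) h5 h6 (by simp)
      (by rcases hb' with rfl | rfl | rfl <;> simp) (by simp)
  · exact line p0 p1 p2 h3 h4 (by simp) (by simp; tauto) (by simp)

/-- If Maker has claimed `w_i` and the rest of the gadget is free of Breaker's vertices, then
Maker can claim `x_{ij}`, and Breaker has to reply in the gadget. -/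
theorem wins_of_spoke {i : Fin 5} {j : Fin 3} (hw : copy a (old (.w i)) ∈ M)
    (hB : ∀ u, gadgetIndex u = some (i, j) → copy a u ∉ B)
    (h : Wins E(G4) (insert (copy a (old (.x i j))) M)
      (B ∪ copy a '' {u | gadgetIndex u = some (i, j) ∧ u ≠ old (.x i j)})) : Wins E(G4) M B := by
  refine .move (hB (old (.x i j)) rfl) fun b _ => ?_
  by_cases hb : b ∈ copy a '' {u | gadgetIndex u = some (i, j) ∧ u ≠ old (.x i j)}
  -- Whatever the reply in the gadget, Breaker may be credited with all of it except `x`.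
  · exact h.mono subset_rfl (Set.insert_subset (.inr hb) Set.subset_union_left)
  have hB' (u : GammaPrimeVertex) (hu : gadgetIndex u = some (i, j)) (hux : u ≠ old (.x i j)) :
      copy a u ∉ insert b B := by
    rintro (rfl | h)
    exacts [hb ⟨u, ⟨hu, hux⟩, rfl⟩, hB u hu h]
  refine .move (hB' (old (.t i j)) rfl (by simp)) fun b' _ => ?_
  exact wins_of_gadget (i := i) (j := j) (by simp [hw]) (by simp) (by simp)
    (fun k => hB' _ rfl (by simp)) (fun k => hB' _ rfl (by simp)) b'

theorem coreIndex_of_gadgetIndex {u : GammaPrimeVertex} {c : Fin 5} {j : Fin 3}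
    (h : gadgetIndex u = some (c + coreShift j, j)) : coreIndex u = some c := by
  simp [coreIndex, h]

theorem exists_of_mem_coreEdge {u : G4Vertex} {c : Fin 5} (h : u ∈ coreEdge a c) :
    u = apex a c ∨ ∃ j, u = copy a (old (.x (c + coreShift j) j)) := by
  simp only [coreEdge, Finset.mem_insert, Finset.mem_singleton] at h
  rcases h with h | h | h | h
  · exact .inl h
  · exact .inr ⟨0, by simpa [coreShift] using h⟩
  · exact .inr ⟨1, h⟩
  · exact .inr ⟨2, h⟩

/-- Two vertices `x` of `e_c` are taken with tempo through their claimed `w`s. The forced replies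
stay in those two gadgets, so the third vertex, in position `j₀`, is still free and completes the
edge. -/
theorem wins_of_core (S : Finset (Fin 5)) {c : Fin 5} (ha : apex a c ∈ M)
    (hS : ∀ k ∈ S, copy a (old (.w k)) ∈ M) (hc : ∃ j₀, ∀ j ≠ j₀, c + coreShift j ∈ S)
    (hB : ∀ u, coreIndex u = some c → copy a u ∉ B) : Wins E(G4) M B := by
  obtain ⟨j₀, hj⟩ := hc
  have h₁ : j₀ + 1 ≠ j₀ := by simp
  have h₂ : j₀ + 2 ≠ j₀ := by simp
  refine wins_of_spoke (j := j₀ + 1) (hS _ (hj _ h₁)) (fun u hu => hB u (coreIndex_of_gadgetIndex hu)) ?_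
  refine wins_of_spoke (j := j₀ + 2) (.inr (hS _ (hj _ h₂))) (fun u hu => ?_) ?_
  · rintro (h | ⟨u', hu', h⟩)
    · exact hB u (coreIndex_of_gadgetIndex hu) h
    · obtain rfl := (copy.inj h).2
      have := hu'.1.symm.trans hu
      simp at this
  · refine .edge (coreEdge_mem a c) (m := copy a (old (.x (c + coreShift j₀) j₀))) ?_ ?_
    · rintro ((h | ⟨u', hu', h⟩) | ⟨u', hu', h⟩)
      · exact hB _ (coreIndex_of_gadgetIndex rfl) h
      · obtain rfl := (copy.inj h).2
        simp [gadgetIndex] at hu'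
      · obtain rfl := (copy.inj h).2
        simp [gadgetIndex] at hu'
    · intro u hu
      rcases exists_of_mem_coreEdge hu with rfl | ⟨j, rfl⟩
      · exact .inr (.inr (.inr ha))
      · have : ∀ j₀ j : Fin 3, j = j₀ ∨ j = j₀ + 1 ∨ j = j₀ + 2 := by decide
        rcases this j₀ j with rfl | rfl | rfl
        exacts [.inl rfl, .inr (.inr (.inl rfl)), .inr (.inl rfl)]

/-- Maker wins by claiming some `w_j` after which two edges `e_c` each contain two positions
played by Maker. -/
theorem wins_of_two_cores (S : Finset (Fin 5)) {j c c' : Fin 5} (ha : ∀ c, apex a c ∈ M)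
    (hS : ∀ k ∈ S, k = j ∨ copy a (old (.w k)) ∈ M) (hj : copy a (old (.w j)) ∉ B) (hne : c ≠ c')
    (hc : ∃ j₀, ∀ j ≠ j₀, c + coreShift j ∈ S) (hc' : ∃ j₀, ∀ j ≠ j₀, c' + coreShift j ∈ S)
    (hB : ∀ u, coreIndex u = some c ∨ coreIndex u = some c' → copy a u ∉ B) :
    Wins E(G4) M B := by
  have hS' : ∀ k ∈ S, copy a (old (.w k)) ∈ insert (copy a (old (.w j))) M := fun k hk =>
    (hS k hk).imp (fun h => by rw [h]) id
  -- The regions of `c` and `c'` are disjoint and contain no `w`, so `b` spoils at most one of the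
  -- two threats.
  refine .move hj fun b _ => ?_
  by_cases hb : ∃ u, coreIndex u = some c ∧ copy a u = b
  · obtain ⟨u, hu, rfl⟩ := hb
    refine wins_of_core S (.inr (ha c')) hS' hc' fun u' hu' => ?_
    rintro (h | h)
    · obtain rfl := (copy.inj h).2
      exact hne (Option.some.inj (hu.symm.trans hu'))
    · exact hB u' (.inr hu') h
  · refine wins_of_core S (.inr (ha c)) hS' hc fun u' hu' => ?_
    rintro (h | h)
    · exact hb ⟨u', hu', h⟩
    · exact hB u' (.inl hu') h

/-- The play below never needs `w (i + 4)` or the region of `i + 1`. Maker starts with `w i`. Unless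
Breaker replies in the region of `i`, a second claim `w (i + 2)` or `w (i + 3)` makes a double
threat, on `e_i` and on `e_{i+2}` or `e_{i+3}` respectively. -/
theorem wins_of_copy_aux (i : Fin 5) (ha : ∀ c, apex a c ∈ M)
    (hB : ∀ u, copy a u ∈ B → u = old (.w (i + 4)) ∨ coreIndex u = some (i + 1)) :
    Wins E(G4) M B := by
  have hwB (k : Fin 5) (hk : k ≠ i + 4) : copy a (old (.w k)) ∉ B := fun h => by
    rcases hB _ h with h | h
    · simp [hk] at h
    · simp [coreIndex, gadgetIndex] at h
  have hcB (c : Fin 5) (hc : c ≠ i + 1) (u : GammaPrimeVertex) (hu : coreIndex u = some c) :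
      copy a u ∉ B := fun h => by
    rcases hB _ h with rfl | h
    · simp [coreIndex, gadgetIndex] at hu
    · exact hc (Option.some.inj (hu.symm.trans h))
  refine .move (m := copy a (old (.w i))) (hwB i (by simp)) fun b₁ _ => ?_
  have two (k : Fin 5) (hk : k ≠ i + 4) (hi : i ≠ i + 1) (hk' : k ≠ i + 1)
      (h₁ : ∃ j₀, ∀ j ≠ j₀, i + coreShift j ∈ ({i, k} : Finset (Fin 5)))
      (h₂ : ∃ j₀, ∀ j ≠ j₀, k + coreShift j ∈ ({i, k} : Finset (Fin 5))) (hik : i ≠ k)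
      (hb : b₁ ≠ copy a (old (.w k)))
      (hb' : ∀ u, coreIndex u = some i ∨ coreIndex u = some k → b₁ ≠ copy a u) :
      Wins E(G4) (insert (copy a (old (.w i))) M) (insert b₁ B) := by
    refine wins_of_two_cores {i, k} (j := k) (fun c => .inr (ha c)) ?_ ?_ hik h₁ h₂ ?_
    · simp
    · rintro (h | h)
      exacts [hb h.symm, hwB k hk h]
    · rintro u hu (h | h)
      · exact hb' u hu h.symm
      · rcases hu with hu | hu
        exacts [hcB _ hi u hu h, hcB _ hk' u hu h]
  by_cases hb₁ : ∃ u, coreIndex u = some i ∧ copy a u = b₁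
  · obtain ⟨u₁, hu₁, rfl⟩ := hb₁
    have hwB₁ (k : Fin 5) (hk : k ≠ i + 4) :
        copy a (old (.w k)) ∉ insert (copy a u₁) B := by
      rintro (h | h)
      · obtain rfl := (copy.inj h).2
        simp [coreIndex, gadgetIndex] at hu₁
      · exact hwB k hk h
    have hcB₁ (c : Fin 5) (hi : c ≠ i) (hc : c ≠ i + 1) (u : GammaPrimeVertex)
        (hu : coreIndex u = some c) : copy a u ∉ insert (copy a u₁) B := by
      rintro (h | h)
      · obtain rfl := (copy.inj h).2
        exact hi (Option.some.inj (hu.symm.trans hu₁))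
      · exact hcB c hc u hu h
    -- With the region of `i` spoiled, `w (i + 1)` threatens `e_{i+3}`, whose first indices are `i +
    -- 3`, `i`, `i + 1`; Breaker must reply in that region.
    refine .move (m := copy a (old (.w (i + 1)))) (hwB₁ _ (by simp)) fun b₂ _ => ?_
    by_cases hb₂ : ∃ u, coreIndex u = some (i + 3) ∧ copy a u = b₂
    · obtain ⟨u₂, hu₂, rfl⟩ := hb₂
      -- The untouched edges `e_{i+2}` and `e_{i+4}` have first indices `i + 2, i + 4, i` and `i +
      -- 4, i + 1, i + 2`, so `w (i + 2)` threatens both.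
      refine wins_of_two_cores {i, i + 1, i + 2} (j := i + 2) (c := i + 2) (c' := i + 4)
        (fun c => .inr (.inr (ha c))) (by simp) ?_ (by simp) ?_ ?_ ?_
      · rintro (h | h)
        · obtain rfl := (copy.inj h).2
          simp [coreIndex, gadgetIndex] at hu₂
        · exact hwB₁ _ (by simp) h
      · clear * -
        revert i
        decide
      · clear * -
        revert i
        decide
      · rintro u hu (h | h)
        · obtain rfl := (copy.inj h).2
          rw [hu₂] at hu
          simp at hu
        · rcases hu with hu | hu
          exacts [hcB₁ _ (by simp) (by simp) u hu h, hcB₁ _ (by simp) (by simp) u hu h]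
    · refine wins_of_core {i, i + 1} (c := i + 3) (.inr (.inr (ha _))) (by simp) ?_ ?_
      · clear * -
        revert i
        decide
      · rintro u hu (h | h)
        · exact hb₂ ⟨u, hu, h⟩
        · exact hcB₁ _ (by simp) (by simp) u hu h
  · have hb₁' (u : GammaPrimeVertex) (hu : coreIndex u = some i) : b₁ ≠ copy a u :=
      fun h => hb₁ ⟨u, hu, h.symm⟩
    by_cases hb₂ : b₁ = copy a (old (.w (i + 2))) ∨
        ∃ u, coreIndex u = some (i + 2) ∧ copy a u = b₁
    · refine two (i + 3) (by simp) (by simp) (by simp) ?_ ?_ (by simp) ?_ ?_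
      · clear * -
        revert i
        decide
      · clear * -
        revert i
        decide
      · rintro rfl
        rcases hb₂ with h | ⟨u, hu, h⟩
        · simp at h
        · obtain rfl := (copy.inj h).2
          simp [coreIndex, gadgetIndex] at hu
      · rintro u (hu | hu)
        · exact hb₁' u hu
        · rintro rfl
          rcases hb₂ with h | ⟨u', hu', h⟩
          · obtain rfl := (copy.inj h).2
            simp [coreIndex, gadgetIndex] at hu
          · obtain rfl := (copy.inj h).2
            rw [hu] at hu'
            simp at hu'
    · push Not at hb₂
      refine two (i + 2) (by simp) (by simp) (by simp) ?_ ?_ (by simp) hb₂.1 ?_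
      · clear * -
        revert i
        decide
      · clear * -
        revert i
        decide
      · rintro u (hu | hu)
        · exact hb₁' u hu
        · exact (hb₂.2 u hu).symm

/-- In a copy of `Γ'` all of whose apexes are Maker's, Maker wins even if Breaker moves first. -/
theorem wins_of_copy (ha : ∀ c, apex a c ∈ M) (hB : ∀ u, copy a u ∉ B) (b : G4Vertex) :
    Wins E(G4) M (insert b B) := by
  have key (i : Fin 5)
      (h : ∀ u, copy a u = b → u = old (.w (i + 4)) ∨ coreIndex u = some (i + 1)) :
      Wins E(G4) M (insert b B) := by
    refine wins_of_copy_aux i ha ?_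
    rintro u (hu | hu)
    exacts [h u hu, (hB u hu).elim]
  -- By cyclic symmetry, `i` is chosen to make Breaker's vertex irrelevant: `w (i + 4)` or a vertex
  -- in the region of `i + 1`.
  by_cases hb : ∃ u, copy a u = b
  · obtain ⟨u, rfl⟩ := hb
    have hcore (c : Fin 5) (hc : coreIndex u = some c) : Wins E(G4) M (insert (copy a u) B) := by
      refine key (c - 1) fun u' hu' => .inr ?_
      obtain rfl := (copy.inj hu').2
      simp [hc]
    rcases u with (⟨k⟩ | ⟨k, j⟩ | ⟨k, j⟩) | ⟨k, j, l⟩ | ⟨k, j, l⟩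
    · refine key (k + 1) fun u' hu' => .inl ?_
      obtain rfl := (copy.inj hu').2
      rw [add_assoc, show (1 + 4 : Fin 5) = 0 by decide, add_zero]
    all_goals exact hcore _ rfl
  · exact key 0 fun u hu => (hb ⟨u, hu⟩).elim

theorem wins_of_apex (hv : v a.castSucc ∈ M) (hs : s a ∉ B) (hB : ∀ u, copy a u ∉ B) :
    Wins E(G4) M B := by
  refine .move hs fun b _ => wins_of_copy (a := a) (fun c => ?_) hB b
  unfold apex
  split_ifs
  exacts [.inr hv, .inl rfl]

/-- `R a` is everything Maker uses after claiming `v a`. These sets are disjoint and contain no `v`,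
so replies forced into `R 0`, `R 1`, `R 2` leave the top edge open. -/
theorem wins_G4 : Wins E(G4) ∅ ∅ := by
  let R (a : Fin 3) : Set G4Vertex := insert (s a) (Set.range (copy a))
  have hv {a : Fin 3} {k : Fin 4} {b : G4Vertex} (hb : b ∈ R a) : v k ≠ b := by
    rintro rfl
    simp [R] at hb
  have hR {a a' : Fin 3} (hne : a ≠ a') {b b' : G4Vertex} (hb : b ∈ R a) (hb' : b' ∈ R a') :
      b' ≠ b := by
    rintro rfl
    rcases hb with rfl | ⟨u, rfl⟩ <;> simp [R, hne, hne.symm] at hb'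
  have step {a : Fin 3} {M B : Set G4Vertex} (hM : v a.castSucc ∈ M) (hB : Disjoint (R a) B) :
      Wins E(G4) M B :=
    wins_of_apex (a := a) hM (Set.disjoint_left.1 hB (.inl rfl))
      fun u => Set.disjoint_left.1 hB (.inr ⟨u, rfl⟩)
  refine .move (m := v 0) (Set.notMem_empty _) fun b₀ _ => ?_
  by_cases h₀ : b₀ ∈ R 0
  swap
  · exact step (a := 0) (.inl rfl) (by simpa using h₀)
  refine .move (m := v 1) (by simpa using hv h₀) fun b₁ _ => ?_
  by_cases h₁ : b₁ ∈ R 1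
  swap
  · refine step (a := 1) (.inl rfl) ?_
    simpa [h₁] using fun h => hR (by decide) h₀ h rfl
  refine .move (m := v 2) (by simpa using ⟨hv h₁, hv h₀⟩) fun b₂ _ => ?_
  by_cases h₂ : b₂ ∈ R 2
  swap
  · refine step (a := 2) (.inl rfl) ?_
    simpa [h₂] using ⟨fun h => hR (by decide) h₁ h rfl, fun h => hR (by decide) h₀ h rfl⟩
  refine .edge topEdge_mem (m := v 3) (by simpa using ⟨hv h₂, hv h₁, hv h₀⟩) ?_
  intro u hu
  simp [topEdge] at hu ⊢
  tauto

theorem makerWins_G4 : MakerWins G4 .maker :=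
  wins_G4.makerWins rfl ⟨_, topEdge_mem⟩

theorem f_four : f 4 = 3 := by
  refine le_antisymm (Nat.sInf_le ⟨G4Vertex, G4, Set.toFinite _, isUniform_G4, maxDegree_G4.le,
    makerWins_G4⟩) ?_
  have := half_lt_f (n := 4) (by norm_num)
  omega

end MakerBreaker

theorem mainTheorem1 :
    -- the explicit hypergraph `G₄`
    (MakerBreaker.G4.IsUniform 4 ∧
      MakerBreaker.G4.maxDegree = 3 ∧
      MakerBreaker.G4.vertexSet.ncard = 562 ∧
      MakerBreaker.G4.edgeSet.ncard = 331 ∧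
      MakerBreaker.MakerWins MakerBreaker.G4 .maker) ∧
    -- the pairing bound
    (∀ (α : Type*) (H : Hypergraph α) (n : ℕ), 1 ≤ n → H.vertexSet.Finite → H.IsUniform n →
      (H.maxDegree : ℝ) ≤ (n : ℝ) / 2 → MakerBreaker.BreakerWins H .maker) ∧
    (∀ n : ℕ, 1 ≤ n → (n : ℝ) / 2 < (MakerBreaker.f n : ℝ)) ∧
    -- the value of `f 4`
    MakerBreaker.f 4 = 3 := by
  refine ⟨⟨MakerBreaker.isUniform_G4, MakerBreaker.maxDegree_G4, MakerBreaker.ncard_vertexSet_G4,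
    MakerBreaker.ncard_edgeSet_G4, MakerBreaker.makerWins_G4⟩, ?_, ?_, MakerBreaker.f_four⟩
  · intro α H n hn hV hH hdeg
    refine MakerBreaker.breakerWins_of_maxDegree_le hn hV hH ?_
    rw [le_div_iff₀ two_pos] at hdeg
    rw [mul_comm]
    exact_mod_cast hdeg
  · intro n hn
    rw [div_lt_iff₀ two_pos, mul_comm]
    exact_mod_cast MakerBreaker.half_lt_f hn
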